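/- Conventions. A multipole is a finite cubic graph in which edges may have free ends (semiedges); loops, parallel edges and edges with two free ends are allowed. Every vertex is incident with exactly three edge ends, and every edge has exactly two ends. A $(2,2;c)$-pole is a multipole with $4+c$ semiedges: an input connector of two semiedges, an output connector of two semiedges, and $c$ residual semiedges; a $(2,2)$-pole is a $(2,2;0)$-pole. The junction of two semiedges merges the two edges carrying them into one. The join $D\circ B$ of a $(2,2)$-pole $D$ and a $(2,2;1)$-pole $B$ is obtained by performing junctions of the output semiedges of $D$ with the input semiedges of $B$ (in any order); its input is that of $D$, and its output and residual semiedge are those of $B$. Let $T$ be a tetrahedron in $PG(3,2)$, spanned by points $p_1,p_2,p_3,p_4$ forming a basis of $\mathbb F_2^4$. Its points are the corner points $p_i$ and the midpoints $p_i+p_j$ ($i\neq j$), and its lines are the six triples $\{p_i,\,p_i+p_j,\,p_j\}$. The weight of a vector is the number of its nonzero coordinates in this basis (corner points have weight $1$, midpoints weight $2$). A $T$-flow on a multipole assigns to each edge a point of $T$ such that the three values around every vertex form a line of $T$. Unordered pairs of (not necessarily distinct) points of $T$ have six shapes, where $c_1,c_2,c_3,c_4$ denote distinct corner points: $\mathtt{ls}$: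 $\{c_1,c_2\}$; $\mathtt{hl}$: $\{c_1,c_1+c_2\}$; $\mathtt{ang}$: $\{c_1+c_2,c_1+c_3\}$; $\mathtt{alt}$: $\{c_1,c_2+c_3\}$; $\mathtt{ax}$: $\{c_1+c_2,c_3+c_4\}$; $\mathtt{dpt}$: $\{x,x\}$. Pairs of shape $\mathtt{ls}$ or $\mathtt{hl}$ are called collinear. For a $(2,2;1)$-pole $X$, the weighted transition relation $\mathbf T(X)$ is the set of all $\mathtt s\overset{i}{\to}\mathtt t$ such that some $T$-flow on $X$ gives the input semiedges values forming a pair of shape $\mathtt s$, the output semiedges values forming a pair of shape $\mathtt t$, and the residual semiedge a value of weight $i$. A decollineator is a $(2,2)$-pole $D$ such that no $T$-flow on $D$ gives collinear pairs on both connectors. A bipartite $(2,2;1)$-pole is obtained from a bipartite cubic graph (parallel edges allowed) by removing a path $uwv$ of length two and keeping the dangling edges; the semiedges formerly incident with $u$, $v$, $w$ form the input, the output and the residual semiedge, respectively. A Halin fragment is a join $D\circ B$ of a decollineator $D$ and a bipartite $(2,2;1)$-pole $B$. A cubic Halin graph $H=C\cup S$ consists of a finite plane tree $S$ all of whose vertices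 have degree $1$ or $3$, with at least one vertex of degree $3$, and a circuit $C$ that passes through all the leaves of $S$ in the order in which they appear around $S$, so that $C\cup S$ is plane. A Halin snark is obtained from $H$ by substituting a Halin fragment $F_v$ for each leaf $v$ of $S$: the output connector of $F_v$ is joined to the input connector of $F_{v'}$, where $v'$ follows $v$ on $C$, and the residual semiedge of $F_v$ is joined to the edge of $S$ that was incident with $v$. A Halin $(2,2;1)$-pole $X$ is created from a Halin snark by removing one Halin fragment $F$ and keeping the dangling edges: the semiedges formerly joined to the output connector, to the input connector and to the residual semiedge of $F$ form, respectively, the input connector, the output connector and the residual semiedge of $X$. Let $$\mathcal D=\{\mathtt{dpt}\to\mathtt{dpt},\ \mathtt{alt}\to\mathtt{alt},\ \mathtt{ax}\to\mathtt{ax},\ \mathtt{ang}\to\mathtt{ang},\ \mathtt{ang}\to\mathtt{ls},\ \mathtt{ls}\to\mathtt{ang}\},$$ and let $\mathcal B$ be the symmetric set of weighted transitions $$\mathcal B=\{\mathtt{dpt}\overset2\leftrightarrow\mathtt{ls},\ \mathtt{dpt}\overset2\leftrightarrow\mathtt{ang},\ \mathtt{ax}\overset2\leftrightarrow\mathtt{ls},\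 \mathtt{ang}\overset2\leftrightarrow\mathtt{ls},\ \mathtt{hl}\overset2\to\mathtt{hl},\ \mathtt{alt}\overset2\to\mathtt{alt},\ \mathtt{hl}\overset2\leftrightarrow\mathtt{alt},\ \mathtt{hl}\overset1\leftrightarrow\mathtt{dpt},\ \mathtt{hl}\overset1\leftrightarrow\mathtt{ls},\ \mathtt{alt}\overset1\leftrightarrow\mathtt{ls}\}.$$ Let $\mathcal D\circ\mathcal B$ consist of all $\mathtt p\overset i\to\mathtt t$ with $(\mathtt p\to\mathtt s)\in\mathcal D$ and $(\mathtt s\overset i\to\mathtt t)\in\mathcal B$ for some $\mathtt s$, and let $\mathcal M=\mathcal D\circ\mathcal B\cup\{\mathtt{ax}\overset1\to\mathtt{hl},\ \mathtt{ls}\overset1\to\mathtt{hl}\}$. Let $\mathcal M\odot\mathcal M$ consist of all $\mathtt p\overset{3-ij}{\longrightarrow}\mathtt t$ with $(\mathtt p\overset i\to\mathtt s),(\mathtt s\overset j\to\mathtt t)\in\mathcal M$ for some $\mathtt s$ and $i+j\le3$. Finally put $\mathcal M'=\mathcal M\odot\mathcal M-\{\mathtt{dpt}\overset1\to\mathtt{alt},\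 \mathtt{alt}\overset1\to\mathtt{dpt}\}$. Theorem 8.3. For every tetrahedron $T$ in $PG(3,2)$, every Halin $(2,2;1)$-pole $X$ satisfies $\mathbf T(X)\subseteq\mathcal M'$. -/

import Mathlib

namespace HalinPole

/-! ### Multipoles -/

/-- The data of a multipole whose semiedges are labelled by `S`: vertices, edges, the edge ends that
are incident with a vertex (`vert a` is the vertex and `edge a` the edge of the end `a`), and the
semiedges, that is, the free edge ends (`semi s` is the edge whose free end is labelled `s`).
Loops, parallel edges and edges with two free ends are allowed. -/
structure Multipole (S : Type) where
  V : Type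
  E : Type
  End : Type
  vert : End → V
  edge : End → E
  semi : S → E

/-- A finite cubic multipole: every vertex is incident with exactly three edge ends, and every edge
has exactly two ends, counting free ends. -/
structure Multipole.IsCubic {S : Type} (M : Multipole S) : Prop where
  finite_V : Finite M.V
  finite_E : Finite M.E
  finite_End : Finite M.End
  three_ends : ∀ v : M.V, Nat.card {a : M.End // M.vert a = v} = 3
  two_ends : ∀ e : M.E, Nat.card {a : M.End ⊕ S // Sum.elim M.edge M.semi a = e} = 2

/-- Labels of the semiedges of a `(2,2;c)`-pole: two in the input connector, two in the output
connector, and `c` residual ones. -/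
inductive Label (c : ℕ) : Type
  | inp (j : Fin 2)
  | out (j : Fin 2)
  | res (k : Fin c)

/-- `(2,2;c)`-poles; a `(2,2)`-pole is a `(2,2;0)`-pole. -/
abbrev Dipole (c : ℕ) : Type 1 := Multipole (Label c)

/-- The disjoint union of two multipoles. -/
def Multipole.sum {S S' : Type} (M : Multipole S) (N : Multipole S') : Multipole (S ⊕ S') where
  V := M.V ⊕ N.V
  E := M.E ⊕ N.E
  End := M.End ⊕ N.End
  vert := Sum.map M.vert N.vert
  edge := Sum.map M.edge N.edge
  semi := Sum.map M.semi N.semi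

/-- The disjoint union of a family of multipoles. -/
def Multipole.sigma {ι S : Type} (M : ι → Multipole S) : Multipole (ι × S) where
  V := Σ i, (M i).V
  E := Σ i, (M i).E
  End := Σ i, (M i).End
  vert := fun a => ⟨a.1, (M a.1).vert a.2⟩
  edge := fun a => ⟨a.1, (M a.1).edge a.2⟩
  semi := fun s => ⟨s.1, (M s.1).semi s.2⟩

/-- The multipole obtained from `M` by performing the junction of the semiedges `s` and `t` whenever
`J s t`: the edges carrying `s` and `t` are merged into one. The semiedges that remain free are
relabelled by `lab`. (Wherever this is used, `J` matches the semiedges outside the range of `lab`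
perfectly, and `lab` is injective.) -/
def Multipole.junction {S S' : Type} (M : Multipole S) (J : S → S → Prop) (lab : S' → S) :
    Multipole S' where
  V := M.V
  E := Quot fun x y : M.E => ∃ s t, J s t ∧ x = M.semi s ∧ y = M.semi t
  End := M.End
  vert := M.vert
  edge := fun a => Quot.mk _ (M.edge a)
  semi := fun s => Quot.mk _ (M.semi (lab s))

/-- The junctions performed in a join: `j`-th output of the first pole to `j`-th input of the second
one. -/
inductive JoinMatch (c : ℕ) : Label 0 ⊕ Label c → Label 0 ⊕ Label c → Prop
  | mk (j : Fin 2) : JoinMatch c (.inl (.out j)) (.inr (.inp j))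

/-- The semiedges of a join: the input of the first pole, the output and the residual semiedges of
the second one. -/
def joinLabel (c : ℕ) : Label c → Label 0 ⊕ Label c
  | .inp j => .inl (.inp j)
  | .out j => .inr (.out j)
  | .res k => .inr (.res k)

/-- The join `D ∘ B` of a `(2,2)`-pole `D` and a `(2,2;c)`-pole `B`. -/
def Multipole.join {c : ℕ} (D : Dipole 0) (B : Dipole c) : Dipole c :=
  (D.sum B).junction (JoinMatch c) (joinLabel c)

/-! ### The tetrahedron and its pairs of points -/

/-- The vector space over the two-element field whose nonzero vectors are the points of
`PG(3,2)`. -/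
abbrev Vec : Type := Fin 4 → ZMod 2

/-- A tetrahedron in `PG(3,2)`, given by its four corner points `T 0, …, T 3` in general position,
that is, by a basis. -/
abbrev Tetrahedron : Type := Module.Basis (Fin 4) (ZMod 2) Vec

/-- The weight of a vector with respect to a tetrahedron: its number of nonzero coordinates. -/
noncomputable def weight (T : Tetrahedron) (x : Vec) : ℕ := (T.repr x).support.card

/-- The ten points of a tetrahedron: the corner points and the midpoints. -/
def IsPoint (T : Tetrahedron) (x : Vec) : Prop :=
  (∃ i, x = T i) ∨ ∃ i j, i ≠ j ∧ x = T i + T j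

/-- The six lines of a tetrahedron. -/
def IsLine (T : Tetrahedron) (l : Set Vec) : Prop :=
  ∃ i j, i ≠ j ∧ l = {T i, T i + T j, T j}

/-- The merged set of shapes: line segments, half-lines, angles, altitudes, axes, and double
points. -/
inductive Shape : Type
  | ls | hl | ang | alt | ax | dpt
  deriving DecidableEq

/-- The unordered pair `z` of (not necessarily distinct) points of `T` has the given shape. -/
def HasShape (T : Tetrahedron) : Shape → Sym2 Vec → Prop
  | .ls, z => ∃ i j, i ≠ j ∧ z = s(T i, T j)
  | .hl, z => ∃ i j, i ≠ j ∧ z = s(T i, T i + T j)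
  | .ang, z => ∃ i j k, i ≠ j ∧ i ≠ k ∧ j ≠ k ∧ z = s(T i + T j, T i + T k)
  | .alt, z => ∃ i j k, i ≠ j ∧ i ≠ k ∧ j ≠ k ∧ z = s(T i, T j + T k)
  | .ax, z => ∃ i j k l, i ≠ j ∧ i ≠ k ∧ i ≠ l ∧ j ≠ k ∧ j ≠ l ∧ k ≠ l ∧
      z = s(T i + T j, T k + T l)
  | .dpt, z => ∃ x, IsPoint T x ∧ z = s(x, x)

/-- A pair is collinear if it is a pair of two distinct points on a line of `T`. -/
def IsCollinear (T : Tetrahedron) (z : Sym2 Vec) : Prop :=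
  ∃ x y l, x ≠ y ∧ IsLine T l ∧ x ∈ l ∧ y ∈ l ∧ z = s(x, y)

/-! ### Tetrahedral flows and transitions -/

/-- A `T`-flow: every edge receives a point of `T`, and the values around each vertex form a line
of `T`. -/
def Multipole.IsFlow {S : Type} (T : Tetrahedron) (M : Multipole S) (φ : M.E → Vec) : Prop :=
  (∀ e, IsPoint T (φ e)) ∧
    ∀ v, IsLine T {x | ∃ a, M.vert a = v ∧ x = φ (M.edge a)}

/-- The transition `z → z'` through a `(2,2)`-pole. -/
def HasTransition (T : Tetrahedron) (X : Dipole 0) (z z' : Sym2 Vec) : Prop :=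
  ∃ φ, X.IsFlow T φ ∧
    s(φ (X.semi (.inp 0)), φ (X.semi (.inp 1))) = z ∧
    s(φ (X.semi (.out 0)), φ (X.semi (.out 1))) = z'

/-- The weighted transition `z → z'` of weight `i` through a `(2,2;1)`-pole. -/
def HasWeightedTransition (T : Tetrahedron) (X : Dipole 1) (z : Sym2 Vec) (i : ℕ)
    (z' : Sym2 Vec) : Prop :=
  ∃ φ, X.IsFlow T φ ∧
    s(φ (X.semi (.inp 0)), φ (X.semi (.inp 1))) = z ∧
    s(φ (X.semi (.out 0)), φ (X.semi (.out 1))) = z' ∧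
    weight T (φ (X.semi (.res 0))) = i

/-- The weighted transition relation on shapes of a `(2,2;1)`-pole: `(s, i, t)` stands for the
transition `s → t` of weight `i`. -/
def transitions (T : Tetrahedron) (X : Dipole 1) : Set (Shape × ℕ × Shape) :=
  {r | ∃ z z', HasShape T r.1 z ∧ HasShape T r.2.2 z' ∧ HasWeightedTransition T X z r.2.1 z'}

/-! ### Halin fragments -/

/-- A decollineator: a (cubic) `(2,2)`-pole without collinear transitions. -/
def IsDecollineator (T : Tetrahedron) (D : Dipole 0) : Prop :=
  D.IsCubic ∧ ∀ z z', HasTransition T D z z' → ¬ (IsCollinear T z ∧ IsCollinear T z')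

/-- A cubic graph: a cubic multipole without semiedges. -/
abbrev Graph : Type 1 := Multipole Empty

/-- The graph is bipartite: the vertices can be coloured with two colours such that the two ends of
every edge are at vertices of different colours. -/
def IsBipartite (G : Graph) : Prop :=
  ∃ col : G.V → Bool, ∀ a b, a ≠ b → G.edge a = G.edge b → col (G.vert a) ≠ col (G.vert b)

/-- The edge `e` joins the distinct vertices `u` and `v`. -/
def Joins (G : Graph) (e : G.E) (u v : G.V) : Prop :=
  u ≠ v ∧ ∃ a b, G.edge a = e ∧ G.edge b = e ∧ G.vert a = u ∧ G.vert b = v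

/-- `B` is the `(2,2;1)`-pole obtained from `G` by removing the vertices `u`, `w`, `v` and the edges
`e = uw`, `f = wv` of a path `uwv`: the vertices and edges of `B` are the remaining ones, and the
edge ends (`ε`) are those of the remaining edges, where the ends formerly at `u`, `v`, `w` become the
input, output and residual semiedges, respectively. -/
def IsPathRemoval (G : Graph) (u w v : G.V) (e f : G.E) (B : Dipole 1) : Prop :=
  u ≠ v ∧ Joins G e u w ∧ Joins G f w v ∧
  ∃ (ν : B.V ≃ {x : G.V // x ≠ u ∧ x ≠ w ∧ x ≠ v})
    (η : B.E ≃ {y : G.E // y ≠ e ∧ y ≠ f})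
    (ε : B.End ⊕ Label 1 ≃ {a : G.End // G.edge a ≠ e ∧ G.edge a ≠ f}),
    (∀ a, G.edge (ε (.inl a)) = η (B.edge a)) ∧
    (∀ s, G.edge (ε (.inr s)) = η (B.semi s)) ∧
    (∀ a, G.vert (ε (.inl a)) = ν (B.vert a)) ∧
    (∀ j, G.vert (ε (.inr (.inp j))) = u) ∧
    (∀ j, G.vert (ε (.inr (.out j))) = v) ∧
    (∀ k, G.vert (ε (.inr (.res k))) = w)

/-- A bipartite `(2,2;1)`-pole: one obtained from a bipartite cubic graph by removing a path of
length two. -/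
def IsBipartitePole (B : Dipole 1) : Prop :=
  ∃ G : Graph, G.IsCubic ∧ IsBipartite G ∧ ∃ u w v e f, IsPathRemoval G u w v e f B

/-- A Halin fragment: the join of a decollineator and a bipartite `(2,2;1)`-pole. -/
def IsHalinFragment (T : Tetrahedron) (F : Dipole 1) : Prop :=
  ∃ (D : Dipole 0) (B : Dipole 1), IsDecollineator T D ∧ IsBipartitePole B ∧ F = D.join B

/-! ### Cubic Halin graphs -/

/-- A dart (directed edge) of a graph that leaves a vertex of degree one. For a tree these are in
bijection with the leaves, and a leaf is represented by the unique dart leaving it. -/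
abbrev LeafDart {V : Type} (S : SimpleGraph V) : Type :=
  {d : S.Dart // (S.neighborSet d.fst).ncard = 1}

/-- A cubic Halin graph `C ∪ S`. The plane tree `S` is given by a tree together with the cyclic
rotation `rot` of the darts leaving each vertex, that is, by a combinatorial embedding in the plane.
The circuit `C` passes through all the leaves, `next` sending a leaf to the following one, and
`C ∪ S` remains embedded in the plane: if we leave a leaf `l` and walk along the contour of the plane
tree (arriving at a vertex along a dart `d`, we continue along the dart that follows the reverse of
`d` in the rotation), then the first leaf that we meet is `next l`. -/
structure HalinGraph where
  V : Type
  finite_V : Finite V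
  S : SimpleGraph V
  isTree : S.IsTree
  cubic : ∀ v, (S.neighborSet v).ncard = 1 ∨ (S.neighborSet v).ncard = 3
  rot : Equiv.Perm S.Dart
  rot_cycle : ∀ d d' : S.Dart, rot.SameCycle d d' ↔ d.fst = d'.fst
  next : Equiv.Perm (LeafDart S)
  circuit : next.IsCycleOn Set.univ
  three_le : 3 ≤ Nat.card (LeafDart S)
  contour : ∀ l : LeafDart S, ∃ m : ℕ, 0 < m ∧
    (fun d : S.Dart => rot d.symm)^[m] l.1 = (next l).1 ∧
    ∀ j, 0 < j → j < m →
      (S.neighborSet ((fun d : S.Dart => rot d.symm)^[j] l.1).fst).ncard ≠ 1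

/-- The leaves of the inscribed tree, that is, the vertices of the perimeter circuit. -/
abbrev HalinGraph.Leaf (H : HalinGraph) : Type := LeafDart H.S

/-- The tree obtained from the inscribed tree `S` by removing the leaves, as a multipole: its vertices
are the trivalent vertices of `S`, its edges are those of `S`, and the pendant edge of each leaf `l`
has a free end, labelled `l`. -/
def HalinGraph.innerTree (H : HalinGraph) : Multipole H.Leaf where
  V := {v : H.V // (H.S.neighborSet v).ncard ≠ 1}
  E := H.S.edgeSet
  End := {d : H.S.Dart // (H.S.neighborSet d.fst).ncard ≠ 1}
  vert := fun d => ⟨d.1.fst, d.2⟩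
  edge := fun d => ⟨d.1.edge, d.1.edge_mem⟩
  semi := fun l => ⟨l.1.edge, l.1.edge_mem⟩

theorem HalinGraph.next_ne (H : HalinGraph) (l : H.Leaf) : H.next l ≠ l := by
  have h3 : 3 ≤ Nat.card H.Leaf := H.three_le
  have : Finite H.Leaf := Nat.finite_of_card_ne_zero (by omega)
  have : Nontrivial H.Leaf := Finite.one_lt_card_iff_nontrivial.1 (by omega)
  exact H.circuit.apply_ne Set.nontrivial_univ (Set.mem_univ l)

theorem HalinGraph.prev_ne (H : HalinGraph) (l : H.Leaf) : H.next.symm l ≠ l := fun h =>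
  H.next_ne l (by conv_lhs => rw [← h, Equiv.apply_symm_apply])

/-! ### Halin snarks and Halin `(2,2;1)`-poles -/

/-- A Halin snark, presented by the underlying Halin graph and the Halin fragment substituted for
each vertex of the perimeter circuit. -/
structure HalinSnark (T : Tetrahedron) where
  H : HalinGraph
  F : H.Leaf → Dipole 1
  isFragment : ∀ l, IsHalinFragment T (F l)

variable {T : Tetrahedron}

/-- The disjoint union of the fragments at the perimeter vertices in `K` and of the inner tree. -/
def HalinSnark.pieces (Γ : HalinSnark T) (K : Set Γ.H.Leaf) :
    Multipole ((K × Label 1) ⊕ Γ.H.Leaf) :=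
  (Multipole.sigma fun l : K => Γ.F l).sum Γ.H.innerTree

/-- The junctions performed among these pieces: the output connector of the fragment at `l` is joined
to the input connector of the fragment at the next vertex of the perimeter circuit, and the residual
semiedge of the fragment at `l` is joined to the free end of the pendant edge of the tree at `l`. -/
inductive HalinSnark.Match (Γ : HalinSnark T) (K : Set Γ.H.Leaf) :
    (K × Label 1) ⊕ Γ.H.Leaf → (K × Label 1) ⊕ Γ.H.Leaf → Prop
  | perimeter (l l' : K) (h : Γ.H.next l = l') (j : Fin 2) :
      HalinSnark.Match Γ K (.inl (l, .out j)) (.inl (l', .inp j))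
  | tree (l : K) (k : Fin 1) : HalinSnark.Match Γ K (.inl (l, .res k)) (.inr l)

/-- The Halin snark itself: all the fragments are present, and no semiedge remains. -/
def HalinSnark.graph (Γ : HalinSnark T) : Graph :=
  (Γ.pieces Set.univ).junction (Γ.Match Set.univ) Empty.elim

/-- The semiedges that arise when the fragment at `x` is removed: those joined in the snark to the
output (input, residual semiedge) of the removed fragment form the input (output, residual semiedge)
of the resulting pole. -/
def HalinSnark.poleLabel (Γ : HalinSnark T) (x : Γ.H.Leaf) :
    Label 1 → (({x}ᶜ : Set Γ.H.Leaf) × Label 1) ⊕ Γ.H.Leaf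
  | .inp j => .inl (⟨Γ.H.next x, Γ.H.next_ne x⟩, .inp j)
  | .out j => .inl (⟨Γ.H.next.symm x, Γ.H.prev_ne x⟩, .out j)
  | .res _ => .inr x

/-- The `(2,2;1)`-pole created from a Halin snark by removing the Halin fragment at the perimeter
vertex `x` and keeping the dangling edges. -/
def HalinSnark.pole (Γ : HalinSnark T) (x : Γ.H.Leaf) : Dipole 1 :=
  (Γ.pieces {x}ᶜ).junction (Γ.Match {x}ᶜ) (Γ.poleLabel x)

/-- Halin `(2,2;1)`-poles. -/
def IsHalinPole (T : Tetrahedron) (X : Dipole 1) : Prop :=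
  ∃ (Γ : HalinSnark T) (x : Γ.H.Leaf), X = Γ.pole x

/-! ### Sets of transitions -/

open Shape

/-- The unweighted transitions admitted by decollineators. -/
def setD : Set (Shape × Shape) :=
  {(dpt, dpt), (alt, alt), (ax, ax), (ang, ang), (ang, ls), (ls, ang)}

/-- One transition from each pair of mutually reverse transitions in `setB`. -/
def halfB : Set (Shape × ℕ × Shape) :=
  {(dpt, 2, ls), (dpt, 2, ang), (ax, 2, ls), (ang, 2, ls), (hl, 2, hl), (alt, 2, alt),
    (hl, 2, alt), (hl, 1, dpt), (hl, 1, ls), (alt, 1, ls)}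

/-- The symmetric set of weighted transitions through bipartite `(2,2;1)`-poles. -/
def setB : Set (Shape × ℕ × Shape) :=
  {r | r ∈ halfB ∨ (r.2.2, r.2.1, r.1) ∈ halfB}

/-- Composition of unweighted with weighted transitions. -/
def compSet (P : Set (Shape × Shape)) (R : Set (Shape × ℕ × Shape)) : Set (Shape × ℕ × Shape) :=
  {r | ∃ s, (r.1, s) ∈ P ∧ (s, r.2.1, r.2.2) ∈ R}

/-- The composition `R₁ ⊙ R₂` of weighted transitions: transitions of weights `i` and `j` with
`i + j ≤ 3` compose to a transition of weight `3 - i * j`. -/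
def odotSet (R₁ R₂ : Set (Shape × ℕ × Shape)) : Set (Shape × ℕ × Shape) :=
  {r | ∃ i s j, (r.1, i, s) ∈ R₁ ∧ (s, j, r.2.2) ∈ R₂ ∧ i + j ≤ 3 ∧ r.2.1 = 3 - i * j}

def setM : Set (Shape × ℕ × Shape) :=
  compSet setD setB ∪ {(ax, 1, hl), (ls, 1, hl)}

def setM' : Set (Shape × ℕ × Shape) :=
  odotSet setM setM \ {(dpt, 1, alt), (alt, 1, dpt)}

end HalinPole

namespace HalinPole

/-! ### Sums over the edge ends of a multipole -/

/-! Two conservation laws constrain the flows. Summed over all edge ends, the values cancel along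
every edge (characteristic two) and around every vertex (the points of a line add up to zero), so
the values on the semiedges sum to zero: this is Kirchhoff's law, `Multipole.IsFlow.sum_semi`. In a
bipartite pole the ends can be given signs according to the colour of their vertex, so cancellation
along edges no longer needs characteristic two, and every function into an abelian group that
vanishes along the lines of `T` is conserved (`IsBipartitePole.sum_eq`). The useful one sends the
corner `p_i` to the unit vector `e_i` of `ℤ⁴` and the midpoint `p_i + p_j` to `-e_i - e_j`.

By Kirchhoff's law a decollineator preserves the sum of a pair. The weight of this sum determines
the shape, except that `ls` and `ang` share weight 2; forbidding collinear transitions leaves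
`setD`. The integral law leaves only `setB` for bipartite poles. Hence every Halin fragment has its
transitions in `setM` (`IsHalinFragment.admissible`).

The points of a line have weights 1, 2, 1, so transitions of weights `i` and `j` that meet at a tree
vertex compose to one of weight `3 - i * j`. The set `setM` is closed under this composition up to
two transitions between `dpt` and `alt`, which Kirchhoff's law excludes: the residual value would
have weight 3, not 1. Therefore `Admissible`, which is Kirchhoff's law together with membership in
`setM`, survives composition (`Admissible.comp`).

Root the tree at the removed leaf `x`. The leaves beyond a dart pointing away from `x` are
consecutive on the contour, so their fragments compose to one admissible transition, by induction
from the leaves towards `x`. The last composition, at the neighbour of `x`, lands in `setM'`. -/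

theorem Multipole.sum_semi_eq_zero {S A : Type} [AddCommGroup A] (M : Multipole S)
    [Fintype M.V] [Fintype M.E] [Fintype M.End] [Fintype S] (g : M.End ⊕ S → A)
    (hE : ∀ e, ∀ α β, α ≠ β → (∀ γ, Sum.elim M.edge M.semi γ = e ↔ γ = α ∨ γ = β) →
      g α + g β = 0)
    (h2 : ∀ e : M.E, Nat.card {a : M.End ⊕ S // Sum.elim M.edge M.semi a = e} = 2)
    (hV : ∀ v, ∀ [Fintype {a : M.End // M.vert a = v}],
      ∑ a : {a : M.End // M.vert a = v}, g (.inl a.1) = 0) :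
    ∑ s, g (.inr s) = 0 := by
  classical
  -- The sum over all ends is evaluated twice: edge by edge here, vertex by vertex below.
  have h1 : ∑ α, g α = 0 := by
    rw [← Fintype.sum_fiberwise (Sum.elim M.edge M.semi)]
    refine Finset.sum_eq_zero fun e _ => ?_
    obtain ⟨⟨α, hα⟩, ⟨β, hβ⟩, hne, huniv⟩ := Nat.card_eq_two_iff.1 (h2 e)
    have hne' : α ≠ β := fun h => hne (Subtype.ext h)
    have hu : (Finset.univ : Finset {a // Sum.elim M.edge M.semi a = e}) =
        {⟨α, hα⟩, ⟨β, hβ⟩} := by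
      apply Finset.coe_injective
      simpa using huniv.symm
    rw [hu, Finset.sum_pair hne]
    refine hE e α β hne' fun γ => ⟨fun hγ => ?_, ?_⟩
    · have : (⟨γ, hγ⟩ : {a // Sum.elim M.edge M.semi a = e}) ∈
          ({⟨α, hα⟩, ⟨β, hβ⟩} : Set _) := huniv ▸ Set.mem_univ _
      simpa using this
    · rintro (rfl | rfl) <;> assumption
  rw [Fintype.sum_sum_type, ← Fintype.sum_fiberwise M.vert,
    Finset.sum_eq_zero fun v _ => hV v, zero_add] at h1
  exact h1

/-- If `f` sums to zero along every line of `T`, then it sums to zero around every vertex of a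
cubic multipole with a `T`-flow. -/
theorem Multipole.IsFlow.sum_vertex {S A : Type} [AddCommGroup A] {T : Tetrahedron}
    {M : Multipole S} {φ : M.E → Vec} (hφ : M.IsFlow T φ) (f : Vec → A)
    (hf : ∀ i j, i ≠ j → f (T i) + f (T i + T j) + f (T j) = 0) (v : M.V)
    (h3 : Nat.card {a : M.End // M.vert a = v} = 3) [Fintype {a : M.End // M.vert a = v}] :
    ∑ a : {a : M.End // M.vert a = v}, f (φ (M.edge a.1)) = 0 := by
  classical
  obtain ⟨i, j, hij, hl⟩ := hφ.2 v
  let q : {a : M.End // M.vert a = v} → Vec := fun a => φ (M.edge a.1)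
  have hTi : T i ≠ 0 := T.ne_zero i
  have hTj : T j ≠ 0 := T.ne_zero j
  have hne : T i ≠ T j := fun h => hij (T.injective h)
  have h1 : T i ≠ T i + T j := by simpa using hTj
  have h2 : T i + T j ≠ T j := by simpa using hTi
  have himg : Finset.univ.image q = {T i, T i + T j, T j} := by
    ext x
    have := Set.ext_iff.1 hl x
    simp only [Set.mem_ofPred_eq, Set.mem_insert_iff, Set.mem_singleton_iff] at this
    simp only [Finset.mem_image, Finset.mem_univ, true_and, Finset.mem_insert,
      Finset.mem_singleton, ← this, q, Subtype.exists]
    exact ⟨fun ⟨a, ha, h⟩ => ⟨a, ha, h.symm⟩, fun ⟨a, ha, h⟩ => ⟨a, ha, h.symm⟩⟩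
  have hcard : (Finset.univ.image q).card = 3 := by
    rw [himg]
    exact Finset.card_eq_three.2 ⟨_, _, _, h1, hne, h2, rfl⟩
  -- A flow only prescribes the set of values at a vertex; three ends taking three distinct values
  -- take each of them exactly once.
  have hinj : Set.InjOn q (Finset.univ : Finset {a : M.End // M.vert a = v}) := by
    apply Finset.card_image_iff.1
    rw [hcard, Finset.card_univ, ← Nat.card_eq_fintype_card, h3]
  change ∑ a, f (q a) = 0
  rw [← Finset.sum_image (f := f) hinj, himg, Finset.sum_insert (by simp [hne, h1]),
    Finset.sum_pair h2, ← add_assoc]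
  exact hf i j hij

theorem add_self_vec (x : Vec) : x + x = 0 := by
  funext i
  exact CharTwo.add_self_eq_zero (x i)

/-- Kirchhoff's law for multipoles. -/
theorem Multipole.IsFlow.sum_semi {S : Type} [Fintype S] {T : Tetrahedron}
    {M : Multipole S} (hM : M.IsCubic) {φ : M.E → Vec} (hφ : M.IsFlow T φ) :
    ∑ s, φ (M.semi s) = 0 := by
  have := hM.finite_V
  have := hM.finite_E
  have := hM.finite_End
  have := Fintype.ofFinite M.V
  have := Fintype.ofFinite M.E
  have := Fintype.ofFinite M.End
  refine M.sum_semi_eq_zero (fun α => φ (Sum.elim M.edge M.semi α)) ?_ hM.two_ends ?_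
  · intro e α β _ h
    rw [(h α).2 (.inl rfl), (h β).2 (.inr rfl), add_self_vec]
  · intro v _
    refine hφ.sum_vertex id (fun i j _ => ?_) v (hM.three_ends v)
    simp only [id]
    rw [add_assoc, add_assoc, add_self_vec, add_zero, add_self_vec]

def Label.equivSum (c : ℕ) : Label c ≃ (Fin 2 ⊕ Fin 2) ⊕ Fin c where
  toFun
    | .inp j => .inl (.inl j)
    | .out j => .inl (.inr j)
    | .res k => .inr k
  invFun
    | .inl (.inl j) => .inp j
    | .inl (.inr j) => .out j
    | .inr k => .res k
  left_inv := by rintro (_ | _ | _) <;> rfl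
  right_inv := by rintro ((_ | _) | _) <;> rfl

instance (c : ℕ) : Fintype (Label c) := Fintype.ofEquiv _ (Label.equivSum c).symm

theorem Label.sum_eq {A : Type} [AddCommMonoid A] {c : ℕ} (g : Label c → A) :
    ∑ s, g s = (g (.inp 0) + g (.inp 1)) + (g (.out 0) + g (.out 1)) + ∑ k, g (.res k) := by
  rw [← (Label.equivSum c).symm.sum_comp, Fintype.sum_sum_type, Fintype.sum_sum_type,
    Fin.sum_univ_two, Fin.sum_univ_two]
  rfl

/-! ### Restricting flows to the pieces of junctions and disjoint unions -/

theorem Multipole.IsFlow.junction {S S' : Type} {T : Tetrahedron} {M : Multipole S}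
    {J : S → S → Prop} {lab : S' → S} {φ : (M.junction J lab).E → Vec}
    (hφ : (M.junction J lab).IsFlow T φ) : M.IsFlow T fun e => φ (Quot.mk _ e) :=
  ⟨fun _ => hφ.1 _, hφ.2⟩

theorem Multipole.junction_mk_eq {S S' : Type} {M : Multipole S}
    {J : S → S → Prop} {lab : S' → S} (φ : (M.junction J lab).E → Vec) {s t : S} (h : J s t) :
    φ (Quot.mk _ (M.semi s)) = φ (Quot.mk _ (M.semi t)) :=
  congrArg φ (Quot.sound ⟨s, t, h, rfl, rfl⟩)

theorem Multipole.IsFlow.sum_left {S S' : Type} {T : Tetrahedron} {M : Multipole S}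
    {N : Multipole S'} {φ : (M.sum N).E → Vec} (hφ : (M.sum N).IsFlow T φ) :
    M.IsFlow T fun e => φ (.inl e) := by
  refine ⟨fun _ => hφ.1 _, fun v => ?_⟩
  convert hφ.2 (.inl v) using 1
  ext x
  constructor
  · rintro ⟨a, rfl, rfl⟩
    exact ⟨.inl a, rfl, rfl⟩
  · rintro ⟨a | a, h, rfl⟩
    · exact ⟨a, Sum.inl.inj h, rfl⟩
    · cases h

theorem Multipole.IsFlow.sum_right {S S' : Type} {T : Tetrahedron} {M : Multipole S}
    {N : Multipole S'} {φ : (M.sum N).E → Vec} (hφ : (M.sum N).IsFlow T φ) :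
    N.IsFlow T fun e => φ (.inr e) := by
  refine ⟨fun _ => hφ.1 _, fun v => ?_⟩
  convert hφ.2 (.inr v) using 1
  ext x
  constructor
  · rintro ⟨a, rfl, rfl⟩
    exact ⟨.inr a, rfl, rfl⟩
  · rintro ⟨a | a, h, rfl⟩
    · cases h
    · exact ⟨a, Sum.inr.inj h, rfl⟩

theorem Multipole.IsFlow.sigma {ι S : Type} {T : Tetrahedron} {M : ι → Multipole S}
    {φ : (Multipole.sigma M).E → Vec} (hφ : (Multipole.sigma M).IsFlow T φ) (i : ι) :
    (M i).IsFlow T fun e => φ ⟨i, e⟩ := by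
  refine ⟨fun _ => hφ.1 _, fun v => ?_⟩
  convert hφ.2 ⟨i, v⟩ using 1
  ext x
  constructor
  · rintro ⟨a, rfl, rfl⟩
    exact ⟨⟨i, a⟩, rfl, rfl⟩
  · rintro ⟨⟨i', a⟩, h, rfl⟩
    obtain ⟨rfl, h⟩ := Sigma.mk.inj h
    exact ⟨a, eq_of_heq h, rfl⟩


/-! ### Coordinates of the points of a tetrahedron -/

/-- The smaller index of the corner points that span the `k`-th point of a tetrahedron. -/
def loIdx : Fin 10 → Fin 4 := ![0, 1, 2, 3, 0, 0, 0, 1, 1, 2]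

/-- The larger index of the corner points that span the `k`-th point of a tetrahedron. -/
def hiIdx : Fin 10 → Fin 4 := ![0, 1, 2, 3, 1, 2, 3, 2, 3, 3]

/-- The number of the point spanned by two corner points. -/
def ptIdx : Fin 4 → Fin 4 → Fin 10 :=
  ![![0, 4, 5, 6], ![4, 1, 7, 8], ![5, 7, 2, 9], ![6, 8, 9, 3]]

/-- The `k`-th point of a tetrahedron. -/
noncomputable def pt (T : Tetrahedron) (k : Fin 10) : Vec :=
  if loIdx k = hiIdx k then T (loIdx k) else T (loIdx k) + T (hiIdx k)

/-- The coordinates of the `k`-th point of a tetrahedron. -/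
def ptCoord (k : Fin 10) : Fin 4 → ZMod 2 := fun i => if i = loIdx k ∨ i = hiIdx k then 1 else 0

variable {T : Tetrahedron}

theorem corner_eq_pt (i : Fin 4) : T i = pt T (ptIdx i i) := by
  fin_cases i <;> simp [pt, ptIdx, loIdx, hiIdx]

theorem midpoint_eq_pt {i j : Fin 4} (h : i ≠ j) : T i + T j = pt T (ptIdx i j) := by
  fin_cases i <;> fin_cases j <;> simp [pt, ptIdx, loIdx, hiIdx] at h ⊢ <;> exact add_comm _ _

theorem IsPoint.exists_pt {x : Vec} (h : IsPoint T x) : ∃ k, x = pt T k := by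
  rcases h with ⟨i, rfl⟩ | ⟨i, j, hij, rfl⟩
  · exact ⟨_, corner_eq_pt i⟩
  · exact ⟨_, midpoint_eq_pt hij⟩

theorem isPoint_pt (k : Fin 10) : IsPoint T (pt T k) := by
  unfold pt
  split_ifs with h
  · exact .inl ⟨_, rfl⟩
  · exact .inr ⟨_, _, h, rfl⟩

theorem repr_pt (k : Fin 10) (i : Fin 4) : T.repr (pt T k) i = ptCoord k i := by
  unfold pt ptCoord
  split_ifs with h h' h'
  · rcases h' with rfl | rfl
    · simp
    · simp [h]
  · push Not at h'
    simp [h'.1.symm]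
  · rcases h' with rfl | rfl
    · simp [Ne.symm h]
    · simp [h]
  · push Not at h'
    simp [h'.1.symm, h'.2.symm]

theorem pt_injective : Function.Injective (pt T) := by
  intro a b h
  have h' : ptCoord a = ptCoord b := by
    funext i
    rw [← repr_pt (T := T), ← repr_pt (T := T), h]
  clear h
  revert a b
  decide

theorem weight_eq (x : Vec) : weight T x = (Finset.univ.filter fun i => T.repr x i ≠ 0).card := by
  unfold weight
  congr 1
  ext i
  simp

theorem weight_pt (k : Fin 10) : weight T (pt T k) = if loIdx k = hiIdx k then 1 else 2 := by
  rw [weight_eq]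
  simp only [repr_pt]
  revert k
  decide

theorem weight_eq_zero {x : Vec} (h : weight T x = 0) : x = 0 := by
  unfold weight at h
  simpa using h

/-! ### Shapes in coordinates -/

instance : Fintype Shape where
  elems := {.ls, .hl, .ang, .alt, .ax, .dpt}
  complete := by rintro (_ | _ | _ | _ | _ | _) <;> decide

/-- The shape of a pair of points of a tetrahedron. -/
def ptShape (a b : Fin 10) : Shape :=
  if a = b then .dpt
  else if loIdx a = hiIdx a then
    if loIdx b = hiIdx b then .ls
    else if loIdx a = loIdx b ∨ loIdx a = hiIdx b then .hl else .alt
  else if loIdx b = hiIdx b then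
    if loIdx b = loIdx a ∨ loIdx b = hiIdx a then .hl else .alt
  else if loIdx a = loIdx b ∨ loIdx a = hiIdx b ∨ hiIdx a = loIdx b ∨ hiIdx a = hiIdx b then .ang
  else .ax

theorem ptShape_comm : ∀ a b, ptShape a b = ptShape b a := by decide

/-- The weight of the sum of a pair of points of the given shape. -/
def Shape.sumWeight : Shape → ℕ
  | .ls => 2
  | .hl => 1
  | .ang => 2
  | .alt => 3
  | .ax => 4
  | .dpt => 0

theorem weight_pt_add (a b : Fin 10) :
    weight T (pt T a + pt T b) = (ptShape a b).sumWeight := by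
  rw [weight_eq]
  simp only [map_add, Finsupp.add_apply, repr_pt]
  revert a b
  decide

/-- Once the ten points are numbered, each shape is a finite condition on indices; this makes shapes
unique and lets all later case analysis be decided on `Fin 10`. -/
theorem HasShape.eq_ptShape {s : Shape} {a b : Fin 10} (h : HasShape T s s(pt T a, pt T b)) :
    s = ptShape a b := by
  have key : ∀ {c d : Fin 10}, s(pt T a, pt T b) = s(pt T c, pt T d) → s = ptShape c d →
      s = ptShape a b := by
    intro c d h hs
    rcases Sym2.eq_iff.1 h with ⟨h1, h2⟩ | ⟨h1, h2⟩
    · rw [pt_injective h1, pt_injective h2, hs]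
    · rw [pt_injective h1, pt_injective h2, hs, ptShape_comm]
  cases s
  · obtain ⟨i, j, hij, h⟩ := h
    rw [corner_eq_pt i, corner_eq_pt j] at h
    refine key h ?_
    clear h key
    revert i j; decide
  · obtain ⟨i, j, hij, h⟩ := h
    rw [midpoint_eq_pt hij, corner_eq_pt i] at h
    refine key h ?_
    clear h key
    revert i j; decide
  · obtain ⟨i, j, k, hij, hik, hjk, h⟩ := h
    rw [midpoint_eq_pt hij, midpoint_eq_pt hik] at h
    refine key h ?_
    clear h key
    revert i j k; decide
  · obtain ⟨i, j, k, hij, hik, hjk, h⟩ := h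
    rw [midpoint_eq_pt hjk, corner_eq_pt i] at h
    refine key h ?_
    clear h key
    revert i j k; decide
  · obtain ⟨i, j, k, l, hij, hik, hil, hjk, hjl, hkl, h⟩ := h
    rw [midpoint_eq_pt hij, midpoint_eq_pt hkl] at h
    refine key h ?_
    clear h key
    have : i ≠ j ∧ i ≠ k ∧ i ≠ l ∧ j ≠ k ∧ j ≠ l ∧ k ≠ l := ⟨hij, hik, hil, hjk, hjl, hkl⟩
    clear hij hik hil hjk hjl hkl
    revert i j k l; decide
  · obtain ⟨x, hx, h⟩ := h
    obtain ⟨k, rfl⟩ := hx.exists_pt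
    refine key h ?_
    simp [ptShape]

theorem isCollinear_of_ptShape {a b : Fin 10} (h : ptShape a b = .ls ∨ ptShape a b = .hl) :
    IsCollinear T s(pt T a, pt T b) := by
  have hne : a ≠ b := by
    rintro rfl
    simp [ptShape] at h
  have hl : ∃ i j, i ≠ j ∧ a ∈ [ptIdx i i, ptIdx i j, ptIdx j j] ∧
      b ∈ [ptIdx i i, ptIdx i j, ptIdx j j] := by
    revert a b; decide
  obtain ⟨i, j, hij, ha, hb⟩ := hl
  refine ⟨pt T a, pt T b, {T i, T i + T j, T j}, fun h => hne (pt_injective h),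
    ⟨i, j, hij, rfl⟩, ?_, ?_, rfl⟩
  all_goals
    rw [midpoint_eq_pt hij, corner_eq_pt i, corner_eq_pt j]
    simp only [List.mem_cons, List.not_mem_nil, or_false] at ha hb
    simp only [Set.mem_insert_iff, Set.mem_singleton_iff, pt_injective.eq_iff]
    assumption

/-! ### Decidability of the sets of transitions -/

instance : DecidablePred (· ∈ setD) := fun r => by
  unfold setD; simp only [Set.mem_insert_iff, Set.mem_singleton_iff]; infer_instance

instance : DecidablePred (· ∈ halfB) := fun r => by
  unfold halfB; simp only [Set.mem_insert_iff, Set.mem_singleton_iff]; infer_instance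

instance : DecidablePred (· ∈ setB) := fun r =>
  inferInstanceAs (Decidable (r ∈ halfB ∨ (r.2.2, r.2.1, r.1) ∈ halfB))

instance : DecidablePred (· ∈ compSet setD setB) := fun r =>
  inferInstanceAs (Decidable (∃ s, (r.1, s) ∈ setD ∧ (s, r.2.1, r.2.2) ∈ setB))

instance : DecidablePred (· ∈ setM) := fun r => by
  unfold setM; simp only [Set.mem_union, Set.mem_insert_iff, Set.mem_singleton_iff]
  infer_instance

/-- `Shape.sumWeight` separates all shapes except `ls` and `ang`. Equality thus leaves the
identities and the exchange of these two, and the second hypothesis removes `hl → hl` and `ls → ls`.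
-/
theorem mem_setD_of_sumWeight_eq : ∀ s t : Shape, s.sumWeight = t.sumWeight →
    ¬ ((s = .ls ∨ s = .hl) ∧ (t = .ls ∨ t = .hl)) → (s, t) ∈ setD := by
  decide

/-- The two transitions added to `compSet setD setB` are what closure requires: `ls → hl` arises
through `dpt` with weights 2 and 1, and then `ax → hl` through `ls` with the same weights. Nonzero
weights with sum at most 3 fit in `Fin 3`, which makes the check finite. -/
theorem setM_odot_closed : ∀ p s t : Shape, ∀ i j : Fin 3, i ≠ 0 → j ≠ 0 → i.1 + j.1 ≤ 3 →
    (p, i.1, s) ∈ setM → (s, j.1, t) ∈ setM →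
    (p, 3 - i.1 * j.1, t) ∈ setM ∨
      (p, 3 - i.1 * j.1, t) = (.dpt, 1, .alt) ∨ (p, 3 - i.1 * j.1, t) = (.alt, 1, .dpt) := by
  decide +kernel

/-! ### The signed count of corner points -/

/-- The signed incidence of the `k`-th point with the corner points, in base `100`. -/
def ptCode (k : Fin 10) : ℤ :=
  if loIdx k = hiIdx k then 100 ^ (loIdx k : ℕ) else -100 ^ (loIdx k : ℕ) - 100 ^ (hiIdx k : ℕ)

/-- The base-100 digits in this equation are too small to carry, so it is one equation in `ℤ⁴`, and
the solutions are enumerated. Symmetry reduces the enumeration to sorted pairs. -/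
theorem mem_setB_of_ptCode {a b c d r : Fin 10}
    (h : ptCode a + ptCode b + (ptCode c + ptCode d) = ptCode r) :
    (ptShape a b, if loIdx r = hiIdx r then 1 else 2, ptShape c d) ∈ setB := by
  have key : ∀ a b : Fin 10, a ≤ b → ∀ c d : Fin 10, c ≤ d → ∀ r : Fin 10,
      ptCode a + ptCode b + (ptCode c + ptCode d) = ptCode r →
      (ptShape a b, if loIdx r = hiIdx r then 1 else 2, ptShape c d) ∈ setB := by
    decide +kernel
  rcases le_total a b with hab | hab <;> rcases le_total c d with hcd | hcd
  · exact key a b hab c d hcd r h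
  · rw [ptShape_comm c d]
    exact key a b hab d c hcd r (by rw [← h]; ring)
  · rw [ptShape_comm a b]
    exact key b a hab c d hcd r (by rw [← h]; ring)
  · rw [ptShape_comm a b, ptShape_comm c d]
    exact key b a hab d c hcd r (by rw [← h]; ring)


/-! ### Decollineators -/

theorem IsDecollineator.mem_setD {D : Dipole 0} (hD : IsDecollineator T D) {φ : D.E → Vec}
    (hφ : D.IsFlow T φ) {a b c d : Fin 10} (ha : φ (D.semi (.inp 0)) = pt T a)
    (hb : φ (D.semi (.inp 1)) = pt T b) (hc : φ (D.semi (.out 0)) = pt T c)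
    (hd : φ (D.semi (.out 1)) = pt T d) :
    pt T a + pt T b = pt T c + pt T d ∧ (ptShape a b, ptShape c d) ∈ setD := by
  have hK := hφ.sum_semi hD.1
  rw [Label.sum_eq, ha, hb, hc, hd, Finset.univ_eq_empty, Finset.sum_empty, add_zero] at hK
  have hK' : pt T a + pt T b = pt T c + pt T d := by
    rw [← add_zero (pt T a + pt T b), ← add_self_vec (pt T c + pt T d), ← add_assoc, hK, zero_add]
  refine ⟨hK', mem_setD_of_sumWeight_eq _ _ ?_ fun h => ?_⟩
  · rw [← weight_pt_add (T := T), ← weight_pt_add (T := T), hK']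
  · refine hD.2 _ _ ⟨φ, hφ, rfl, rfl⟩ ?_
    rw [ha, hb, hc, hd]
    exact ⟨isCollinear_of_ptShape h.1, isCollinear_of_ptShape h.2⟩

/-! ### Bipartite poles -/

/-- A two-colouring `κ` of the ends of a `(2,2;1)`-pole that is constant around every vertex and
changes along every edge; the residual semiedge has the colour opposite to the other ones. -/
structure IsEndColoring (B : Dipole 1) (κ : B.End ⊕ Label 1 → Bool) : Prop where
  vert : ∀ a b, B.vert a = B.vert b → κ (.inl a) = κ (.inl b)
  edge : ∀ α β, α ≠ β → Sum.elim B.edge B.semi α = Sum.elim B.edge B.semi β → κ α ≠ κ β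
  inp : ∀ j k, κ (.inr (.inp j)) ≠ κ (.inr (.res k))
  out : ∀ j k, κ (.inr (.out j)) ≠ κ (.inr (.res k))

theorem Joins.vert_eq {G : Graph} (hG : G.IsCubic) {e : G.E} {u v : G.V} (h : Joins G e u v)
    {c : G.End} (hc : G.edge c = e) : G.vert c = u ∨ G.vert c = v := by
  obtain ⟨huv, a, b, ha, hb, rfl, rfl⟩ := h
  by_contra! hne
  obtain ⟨x, y, -, huniv⟩ := Nat.card_eq_two_iff.1 (hG.two_ends e)
  have mem : ∀ z (hz : G.edge z = e),
      (⟨.inl z, hz⟩ : {α : G.End ⊕ Empty // Sum.elim G.edge G.semi α = e}) = x ∨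
        (⟨.inl z, hz⟩ : {α : G.End ⊕ Empty // Sum.elim G.edge G.semi α = e}) = y := fun z hz => by
    have : _ ∈ ({x, y} : Set _) := huniv ▸ Set.mem_univ
      (⟨.inl z, hz⟩ : {α : G.End ⊕ Empty // Sum.elim G.edge G.semi α = e})
    simpa using this
  have inj : ∀ {z w hz hw t}, (⟨.inl z, hz⟩ : {α : G.End ⊕ Empty // Sum.elim G.edge G.semi α = e})
      = t → ⟨.inl w, hw⟩ = t → G.vert z = G.vert w := by
    intro z w hz hw t h1 h2
    have := h1.trans h2.symm
    simp only [Subtype.mk.injEq, Sum.inl.injEq] at this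
    rw [this]
  rcases mem a ha with h1 | h1 <;> rcases mem b hb with h2 | h2 <;> rcases mem c hc with h3 | h3 <;>
    first
    | exact huv (inj h1 h2)
    | exact hne.1 (inj h3 h1)
    | exact hne.2 (inj h3 h2)

/-- Each removed edge has both its ends at `u`, `w` or `v`, so no remaining vertex loses an end, and
no remaining edge loses one either: its ends at removed vertices become free. -/
theorem IsPathRemoval.isCubic {G : Graph} (hG : G.IsCubic) {u w v : G.V} {e f : G.E}
    {B : Dipole 1} (h : IsPathRemoval G u w v e f B) : B.IsCubic := by
  obtain ⟨-, he, hf, ν, η, ε, hedge, hsemi, hvert, hinp, hout, hres⟩ := h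
  have := hG.finite_V
  have := hG.finite_E
  have := hG.finite_End
  have hfin := Finite.of_equiv _ ε.symm
  have hall : ∀ α, G.edge (ε α) = η (Sum.elim B.edge B.semi α) := by
    rintro (a | s)
    exacts [hedge a, hsemi s]
  refine ⟨Finite.of_equiv _ ν.symm, Finite.of_equiv _ η.symm,
    Finite.of_injective (fun a : B.End => (Sum.inl a : B.End ⊕ Label 1)) Sum.inl_injective, ?_, ?_⟩
  · intro x
    rw [← hG.three_ends (ν x)]
    refine Nat.card_congr (Equiv.ofBijective
      (fun a => ⟨(ε (.inl a.1)).1, by rw [hvert, a.2]⟩) ⟨?_, ?_⟩)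
    · rintro ⟨a, ha⟩ ⟨b, hb⟩ hab
      simp only [Subtype.mk.injEq] at hab ⊢
      exact Sum.inl_injective (ε.injective (Subtype.ext hab))
    · rintro ⟨c, hc⟩
      have hx := (ν x).2
      have hce : G.edge c ≠ e := fun h => by
        rcases he.vert_eq hG h with h | h
        exacts [hx.1 (hc.symm.trans h), hx.2.1 (hc.symm.trans h)]
      have hcf : G.edge c ≠ f := fun h => by
        rcases hf.vert_eq hG h with h | h
        exacts [hx.2.1 (hc.symm.trans h), hx.2.2 (hc.symm.trans h)]
      obtain ⟨α, hα⟩ := ε.surjective ⟨c, hce, hcf⟩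
      have hαc : (ε α).1 = c := congrArg Subtype.val hα
      rcases α with a | (j | j | k)
      · refine ⟨⟨a, ν.injective (Subtype.ext ?_)⟩, Subtype.ext hαc⟩
        rw [← hvert, hαc, hc]
      · exact absurd (by rw [← hc, ← hαc, hinp]) hx.1
      · exact absurd (by rw [← hc, ← hαc, hout]) hx.2.2
      · exact absurd (by rw [← hc, ← hαc, hres]) hx.2.1
  · intro y
    rw [← hG.two_ends (η y)]
    refine Nat.card_congr (Equiv.ofBijective
      (fun α => ⟨.inl (ε α.1).1, by rw [Sum.elim_inl, hall, α.2]⟩) ⟨?_, ?_⟩)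
    · rintro ⟨a, ha⟩ ⟨b, hb⟩ hab
      simp only [Subtype.mk.injEq, Sum.inl.injEq] at hab ⊢
      exact ε.injective (Subtype.ext hab)
    · rintro ⟨c | c, hc⟩
      · change G.edge c = η y at hc
        obtain ⟨α, hα⟩ := ε.surjective ⟨c, by rw [hc]; exact (η y).2⟩
        have hαc : (ε α).1 = c := congrArg Subtype.val hα
        refine ⟨⟨α, η.injective (Subtype.ext ?_)⟩, Subtype.ext (congrArg Sum.inl hαc)⟩
        rw [← hall, hαc, hc]
      · exact c.elim

/-- Every end, free or not, inherits the colour of its vertex in `G`; both `u` and `v` are adjacent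
to `w`, which gives the residual semiedge the opposite colour. -/
theorem IsPathRemoval.exists_isEndColoring {G : Graph} (hG : IsBipartite G)
    {u w v : G.V} {e f : G.E} {B : Dipole 1} (h : IsPathRemoval G u w v e f B) :
    ∃ κ, IsEndColoring B κ := by
  obtain ⟨-, he, hf, ν, η, ε, hedge, hsemi, hvert, hinp, hout, hres⟩ := h
  obtain ⟨col, hcol⟩ := hG
  have hall : ∀ α, G.edge (ε α) = η (Sum.elim B.edge B.semi α) := by
    rintro (a | s)
    exacts [hedge a, hsemi s]
  have hjoin : ∀ {e u v}, Joins G e u v → col u ≠ col v := by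
    rintro e _ _ ⟨huv, a, b, ha, hb, rfl, rfl⟩
    exact hcol a b (fun h => huv (by rw [h])) (ha.trans hb.symm)
  refine ⟨fun α => col (G.vert (ε α)), ⟨?_, ?_, ?_, ?_⟩⟩
  · intro a b hab
    simp only [hvert, hab]
  · intro α β hne hαβ
    exact hcol _ _ (fun h => hne (ε.injective (Subtype.ext h))) (by rw [hall, hall, hαβ])
  · intro j k
    simp only [hinp, hres]
    exact hjoin he
  · intro j k
    simp only [hout, hres]
    exact (hjoin hf).symm

theorem IsBipartitePole.isCubic {B : Dipole 1} (hB : IsBipartitePole B) : B.IsCubic := by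
  obtain ⟨G, hG, -, u, w, v, e, f, h⟩ := hB
  exact h.isCubic hG

/-- If `f` sums to zero along every line of `T`, then the value of `f` on the residual semiedge of a
bipartite pole is the sum of its values on the other semiedges. -/
theorem IsBipartitePole.sum_eq {A : Type} [AddCommGroup A] {B : Dipole 1}
    (hB : IsBipartitePole B) {φ : B.E → Vec} (hφ : B.IsFlow T φ) (f : Vec → A)
    (hf : ∀ i j, i ≠ j → f (T i) + f (T i + T j) + f (T j) = 0) :
    f (φ (B.semi (.inp 0))) + f (φ (B.semi (.inp 1))) +
      (f (φ (B.semi (.out 0))) + f (φ (B.semi (.out 1)))) = f (φ (B.semi (.res 0))) := by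
  have hcubic := hB.isCubic
  obtain ⟨G, -, hbip, u, w, v, e, f', h⟩ := hB
  obtain ⟨κ, hκ⟩ := h.exists_isEndColoring hbip
  have := hcubic.finite_V
  have := hcubic.finite_E
  have := hcubic.finite_End
  have := Fintype.ofFinite B.V
  have := Fintype.ofFinite B.E
  have := Fintype.ofFinite B.End
  -- The sign is constant around a vertex and changes along an edge; it is negative on the residual
  -- semiedge and positive on the four others.
  let g : B.End ⊕ Label 1 → A := fun α =>
    if κ α = κ (.inr (.res 0)) then -f (φ (Sum.elim B.edge B.semi α))
    else f (φ (Sum.elim B.edge B.semi α))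
  have hsum : ∑ s, g (.inr s) = 0 := by
    refine B.sum_semi_eq_zero g ?_ hcubic.two_ends ?_
    · intro e α β hne h
      have hα := (h α).2 (.inl rfl)
      have hβ := (h β).2 (.inr rfl)
      have hc := hκ.edge α β hne (hα.trans hβ.symm)
      simp only [g, hα, hβ]
      revert hc
      cases κ α <;> cases κ β <;> cases κ (.inr (.res 0)) <;> simp
    · intro v _
      by_cases hv : ∃ a, B.vert a = v ∧ κ (.inl a) = κ (.inr (.res 0))
      · obtain ⟨a₀, ha₀, hc⟩ := hv
        have : ∀ a : {a : B.End // B.vert a = v}, g (.inl a.1) = -f (φ (B.edge a.1)) := fun a => by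
          simp only [g, Sum.elim_inl]
          rw [if_pos (by rw [← hc]; exact hκ.vert _ _ (a.2.trans ha₀.symm))]
        rw [Finset.sum_congr rfl fun a _ => this a, Finset.sum_neg_distrib,
          hφ.sum_vertex f hf v (hcubic.three_ends v), neg_zero]
      · have : ∀ a : {a : B.End // B.vert a = v}, g (.inl a.1) = f (φ (B.edge a.1)) := fun a => by
          simp only [g, Sum.elim_inl]
          rw [if_neg fun hc => hv ⟨a.1, a.2, hc⟩]
        rw [Finset.sum_congr rfl fun a _ => this a,
          hφ.sum_vertex f hf v (hcubic.three_ends v)]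
  rw [Label.sum_eq, Fin.sum_univ_one] at hsum
  simp only [g, hκ.inp, hκ.out, if_true, if_false, Sum.elim_inr] at hsum
  exact add_neg_eq_zero.1 hsum

theorem IsBipartitePole.mem_setB {B : Dipole 1} (hB : IsBipartitePole B) {φ : B.E → Vec}
    (hφ : B.IsFlow T φ) {a b c d r : Fin 10} (ha : φ (B.semi (.inp 0)) = pt T a)
    (hb : φ (B.semi (.inp 1)) = pt T b) (hc : φ (B.semi (.out 0)) = pt T c)
    (hd : φ (B.semi (.out 1)) = pt T d) (hr : φ (B.semi (.res 0)) = pt T r) :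
    pt T a + pt T b + (pt T c + pt T d) = pt T r ∧
      (ptShape a b, weight T (pt T r), ptShape c d) ∈ setB := by
  constructor
  · have hK := hφ.sum_semi hB.isCubic
    rw [Label.sum_eq, Fin.sum_univ_one, ha, hb, hc, hd, hr] at hK
    rw [← add_zero (pt T a + pt T b + _), ← add_self_vec (pt T r), ← add_assoc, hK, zero_add]
  · let f : Vec → ℤ := Function.extend (pt T) ptCode 0
    have hpt : ∀ k, f (pt T k) = ptCode k := fun k => pt_injective.extend_apply _ _ k
    have h := hB.sum_eq hφ f fun i j hij => by
      rw [midpoint_eq_pt hij, corner_eq_pt i, corner_eq_pt j, hpt, hpt, hpt]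
      revert i j
      decide
    rw [ha, hb, hc, hd, hr, hpt, hpt, hpt, hpt, hpt] at h
    rw [weight_pt]
    exact mem_setB_of_ptCode h

/-! ### Halin fragments -/

/-- The sum of an unordered pair of vectors. -/
def pairSum (z : Sym2 Vec) : Vec := Sym2.lift ⟨fun x y => x + y, add_comm⟩ z

/-- The weighted transition `z → z'` with residual value `x` satisfies Kirchhoff's law and its
shape belongs to `setM`. -/
def Admissible (T : Tetrahedron) (z : Sym2 Vec) (x : Vec) (z' : Sym2 Vec) : Prop :=
  pairSum z + pairSum z' = x ∧
    ∃ p t, HasShape T p z ∧ HasShape T t z' ∧ (p, weight T x, t) ∈ setM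

theorem HasShape.exists_pt {s : Shape} {z : Sym2 Vec} (h : HasShape T s z) :
    ∃ a b, z = s(pt T a, pt T b) := by
  cases s
  · obtain ⟨i, j, hij, rfl⟩ := h
    exact ⟨_, _, congrArg₂ (fun x y => s(x, y)) (corner_eq_pt i) (corner_eq_pt j)⟩
  · obtain ⟨i, j, hij, rfl⟩ := h
    exact ⟨_, _, congrArg₂ (fun x y => s(x, y)) (corner_eq_pt i) (midpoint_eq_pt hij)⟩
  · obtain ⟨i, j, k, hij, hik, hjk, rfl⟩ := h
    exact ⟨_, _, congrArg₂ (fun x y => s(x, y)) (midpoint_eq_pt hij) (midpoint_eq_pt hik)⟩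
  · obtain ⟨i, j, k, hij, hik, hjk, rfl⟩ := h
    exact ⟨_, _, congrArg₂ (fun x y => s(x, y)) (corner_eq_pt i) (midpoint_eq_pt hjk)⟩
  · obtain ⟨i, j, k, l, hij, hik, hil, hjk, hjl, hkl, rfl⟩ := h
    exact ⟨_, _, congrArg₂ (fun x y => s(x, y)) (midpoint_eq_pt hij) (midpoint_eq_pt hkl)⟩
  · obtain ⟨x, hx, rfl⟩ := h
    obtain ⟨k, rfl⟩ := hx.exists_pt
    exact ⟨k, k, rfl⟩

theorem HasShape.unique {s s' : Shape} {z : Sym2 Vec} (h : HasShape T s z)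
    (h' : HasShape T s' z) : s = s' := by
  obtain ⟨a, b, rfl⟩ := h.exists_pt
  rw [h.eq_ptShape, h'.eq_ptShape]

theorem HasShape.weight_pairSum {s : Shape} {z : Sym2 Vec} (h : HasShape T s z) :
    weight T (pairSum z) = s.sumWeight := by
  obtain ⟨a, b, rfl⟩ := h.exists_pt
  rw [h.eq_ptShape]
  exact weight_pt_add a b

theorem hasShape_ptShape (a b : Fin 10) : HasShape T (ptShape a b) s(pt T a, pt T b) := by
  have hls : ∀ a b, ptShape a b = .ls → ∃ i j, i ≠ j ∧ a = ptIdx i i ∧ b = ptIdx j j := by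
    decide
  have hhl : ∀ a b, ptShape a b = .hl → ∃ i j, i ≠ j ∧
      (a = ptIdx i i ∧ b = ptIdx i j ∨ b = ptIdx i i ∧ a = ptIdx i j) := by
    decide
  have hang : ∀ a b, ptShape a b = .ang → ∃ i j k, i ≠ j ∧ i ≠ k ∧ j ≠ k ∧
      a = ptIdx i j ∧ b = ptIdx i k := by
    decide
  have halt : ∀ a b, ptShape a b = .alt → ∃ i j k, i ≠ j ∧ i ≠ k ∧ j ≠ k ∧
      (a = ptIdx i i ∧ b = ptIdx j k ∨ b = ptIdx i i ∧ a = ptIdx j k) := by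
    decide
  have hax : ∀ a b, ptShape a b = .ax → ∃ i j k l, i ≠ j ∧ i ≠ k ∧ i ≠ l ∧ j ≠ k ∧ j ≠ l ∧ k ≠ l ∧
      a = ptIdx i j ∧ b = ptIdx k l := by
    decide
  have hdpt : ∀ a b, ptShape a b = .dpt → a = b := by decide
  cases h : ptShape a b
  · obtain ⟨i, j, hij, rfl, rfl⟩ := hls a b h
    exact ⟨i, j, hij, by rw [← corner_eq_pt, ← corner_eq_pt]⟩
  · obtain ⟨i, j, hij, ⟨rfl, rfl⟩ | ⟨rfl, rfl⟩⟩ := hhl a b h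
    · exact ⟨i, j, hij, by rw [← corner_eq_pt, ← midpoint_eq_pt hij]⟩
    · exact ⟨i, j, hij, by rw [← corner_eq_pt, ← midpoint_eq_pt hij, Sym2.eq_swap]⟩
  · obtain ⟨i, j, k, hij, hik, hjk, rfl, rfl⟩ := hang a b h
    exact ⟨i, j, k, hij, hik, hjk, by rw [← midpoint_eq_pt hij, ← midpoint_eq_pt hik]⟩
  · obtain ⟨i, j, k, hij, hik, hjk, ⟨rfl, rfl⟩ | ⟨rfl, rfl⟩⟩ := halt a b h
    · exact ⟨i, j, k, hij, hik, hjk, by rw [← corner_eq_pt, ← midpoint_eq_pt hjk]⟩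
    · exact ⟨i, j, k, hij, hik, hjk, by
        rw [← corner_eq_pt, ← midpoint_eq_pt hjk, Sym2.eq_swap]⟩
  · obtain ⟨i, j, k, l, hij, hik, hil, hjk, hjl, hkl, rfl, rfl⟩ := hax a b h
    exact ⟨i, j, k, l, hij, hik, hil, hjk, hjl, hkl, by
      rw [← midpoint_eq_pt hij, ← midpoint_eq_pt hkl]⟩
  · obtain rfl := hdpt a b h
    exact ⟨_, isPoint_pt _, rfl⟩

theorem IsHalinFragment.admissible {F : Dipole 1} (hF : IsHalinFragment T F) {φ : F.E → Vec}
    (hφ : F.IsFlow T φ) :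
    Admissible T s(φ (F.semi (.inp 0)), φ (F.semi (.inp 1))) (φ (F.semi (.res 0)))
      s(φ (F.semi (.out 0)), φ (F.semi (.out 1))) := by
  obtain ⟨D, B, hD, hB, rfl⟩ := hF
  have hφD := hφ.junction.sum_left
  have hφB := hφ.junction.sum_right
  have hJ : ∀ j, φ (Quot.mk _ (.inl (D.semi (.out j)))) = φ (Quot.mk _ (.inr (B.semi (.inp j)))) :=
    fun j => Multipole.junction_mk_eq (M := D.sum B) φ (JoinMatch.mk j)
  obtain ⟨a, ha⟩ := (hφD.1 (D.semi (.inp 0))).exists_pt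
  obtain ⟨b, hb⟩ := (hφD.1 (D.semi (.inp 1))).exists_pt
  obtain ⟨c, hc⟩ := (hφD.1 (D.semi (.out 0))).exists_pt
  obtain ⟨d, hd⟩ := (hφD.1 (D.semi (.out 1))).exists_pt
  obtain ⟨c', hc'⟩ := (hφB.1 (B.semi (.out 0))).exists_pt
  obtain ⟨d', hd'⟩ := (hφB.1 (B.semi (.out 1))).exists_pt
  obtain ⟨r, hr⟩ := (hφB.1 (B.semi (.res 0))).exists_pt
  obtain ⟨hK, h1⟩ := hD.mem_setD hφD ha hb hc hd
  obtain ⟨hK', h2⟩ := hB.mem_setB hφB ((hJ 0).symm.trans hc) ((hJ 1).symm.trans hd) hc' hd' hr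
  change Admissible T s(φ (Quot.mk _ (.inl (D.semi (.inp 0)))), φ (Quot.mk _ (.inl (D.semi _))))
    (φ (Quot.mk _ (.inr (B.semi _))))
    s(φ (Quot.mk _ (.inr (B.semi _))), φ (Quot.mk _ (.inr (B.semi _))))
  dsimp only at ha hb hc' hd' hr
  rw [ha, hb, hc', hd', hr]
  refine ⟨?_, _, _, hasShape_ptShape a b, hasShape_ptShape c' d', .inl ⟨_, h1, h2⟩⟩
  rw [← hK', ← hK]
  rfl

/-! ### Composition of transitions at a vertex of the inner tree -/

theorem weight_corner (i : Fin 4) : weight T (T i) = 1 := by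
  rw [corner_eq_pt, weight_pt]
  revert i
  decide

theorem weight_midpoint {i j : Fin 4} (h : i ≠ j) : weight T (T i + T j) = 2 := by
  rw [midpoint_eq_pt h, weight_pt]
  revert i j
  decide

theorem weight_of_isLine {x y r : Vec} (h : IsLine T {x, y, r}) :
    r = x + y ∧ weight T x ≠ 0 ∧ weight T y ≠ 0 ∧ weight T x + weight T y ≤ 3 ∧
      weight T r = 3 - weight T x * weight T y := by
  obtain ⟨i, j, hij, hl⟩ := h
  have h1 : T i ≠ T i + T j := by simpa using T.ne_zero j
  have h2 : T i + T j ≠ T j := by simpa using T.ne_zero i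
  have h3 : T i ≠ T j := fun h => hij (T.injective h)
  have mem : ∀ z, (z = x ∨ z = y ∨ z = r) ↔ z = T i ∨ z = T i + T j ∨ z = T j :=
    fun z => by simpa using Set.ext_iff.1 hl z
  have ha : T i + (T i + T j) = T j := by rw [← add_assoc, add_self_vec, zero_add]
  have hb : T i + T j + T j = T i := by rw [add_assoc, add_self_vec, add_zero]
  have hr : ∀ z, z ≠ x → z ≠ y → (z = T i ∨ z = T i + T j ∨ z = T j) → r = z :=
    fun z hx hy hz => by
      rcases (mem z).2 hz with h | h | h
      exacts [absurd h hx, absurd h hy, h.symm]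
  -- If `x = y`, the two points of the line other than `x` would both equal `r`.
  have hxy : x ≠ y := by
    rintro rfl
    rcases (mem x).1 (.inl rfl) with rfl | rfl | rfl
    · exact h2 ((hr _ h1.symm h1.symm (by simp)).symm.trans (hr _ h3.symm h3.symm (by simp)))
    · exact h3 ((hr _ h1 h1 (by simp)).symm.trans (hr _ h2.symm h2.symm (by simp)))
    · exact h1 ((hr _ h3 h3 (by simp)).symm.trans (hr _ h2 h2 (by simp)))
  have wi := weight_corner (T := T) i
  have wj := weight_corner (T := T) j
  have wm := weight_midpoint (T := T) hij
  rcases (mem x).1 (.inl rfl) with rfl | rfl | rfl <;>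
    rcases (mem y).1 (.inr (.inl rfl)) with rfl | rfl | rfl
  · exact absurd rfl hxy
  · rw [hr (T j) h3.symm h2.symm (by simp), ha, wi, wj, wm]; simp
  · rw [hr (T i + T j) h1.symm h2 (by simp), wi, wj, wm]; simp
  · rw [hr (T j) h2.symm h3.symm (by simp), add_comm (_ + _), ha, wi, wj, wm]; simp
  · exact absurd rfl hxy
  · rw [hr (T i) h1 h3 (by simp), hb, wi, wj, wm]; simp
  · rw [hr (T i + T j) h2 h1.symm (by simp), add_comm (T j), wi, wj, wm]; simp
  · rw [hr (T i) h3 h1 (by simp), add_comm (T j), hb, wi, wj, wm]; simp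
  · exact absurd rfl hxy

/-- The first conclusion is the invariant to be iterated along the tree; the second, sharper one is
used only at the last vertex. -/
theorem Admissible.comp {z z' z'' : Sym2 Vec} {x y r : Vec} (h : Admissible T z x z')
    (h' : Admissible T z' y z'') (hl : IsLine T {x, y, r}) :
    Admissible T z r z'' ∧
      ∃ p t, HasShape T p z ∧ HasShape T t z'' ∧ (p, weight T r, t) ∈ setM' := by
  obtain ⟨hs, p, s, hp, hs1, hM⟩ := h
  obtain ⟨hs', s', t, hs2, ht, hM'⟩ := h'
  obtain rfl := hs1.unique hs2
  obtain ⟨hr, hx0, hy0, hle, hw⟩ := weight_of_isLine hl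
  have hK : pairSum z + pairSum z'' = r := by
    rw [hr, ← hs, ← hs', add_assoc, ← add_assoc (pairSum z'), add_self_vec, zero_add]
  -- A `dpt` pair has sum 0 and an `alt` pair has a sum of weight 3, so Kirchhoff's law would give
  -- `r` weight 3.
  have hexcl : (p, weight T r, t) ∉ ({(.dpt, 1, .alt), (.alt, 1, .dpt)} :
      Set (Shape × ℕ × Shape)) := by
    have hp' := hp.weight_pairSum
    have ht' := ht.weight_pairSum
    rintro (h | h)
    all_goals
      simp only [Set.mem_singleton_iff, Prod.mk.injEq] at h
      obtain ⟨rfl, h1, rfl⟩ := h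
    · rw [← hK, weight_eq_zero hp', zero_add, ht'] at h1
      simp [Shape.sumWeight] at h1
    · rw [← hK, weight_eq_zero ht', add_zero, hp'] at h1
      simp [Shape.sumWeight] at h1
  refine ⟨⟨hK, p, t, hp, ht, ?_⟩, p, t, hp, ht, ⟨_, s, _, hM, hM', hle, hw⟩, hexcl⟩
  have := setM_odot_closed p s t ⟨weight T x, by omega⟩ ⟨weight T y, by omega⟩
    (by simpa [Fin.ext_iff] using hx0) (by simpa [Fin.ext_iff] using hy0) hle hM hM'
  simp only [← hw] at this
  exact this.resolve_right fun h => hexcl (by simpa using h)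


/-! ### The contour of a plane tree -/

/-- In a tree the neighbour of `v` nearer to `x` is unique, namely the penultimate vertex of the
path from `x` to `v`. Here it is `u`, so a walk that leads away from `x` keeps doing so until it
backtracks. -/
theorem isTree_dist_lt {V : Type} {S : SimpleGraph V} (hS : S.IsTree) {x u v w : V}
    (huv : S.Adj u v) (hvw : S.Adj v w) (hd : S.dist x v = S.dist x u + 1) (hne : w ≠ u) :
    S.dist x w = S.dist x v + 1 := by
  refine (hS.dist_eq_dist_add_one_of_adj x hvw).resolve_left fun h => hne ?_
  obtain ⟨p, hp, -⟩ := hS.existsUnique_path x v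
  have key : ∀ t, S.Adj v t → S.dist x v = S.dist x t + 1 → t = p.penultimate := by
    intro t ht hdt
    refine hS.isAcyclic.eq_penultimate_of_adj_end hp ht ?_
    obtain ⟨q, hq, hql⟩ := (hS.connected.preconnected x t).exists_path_of_dist
    refine hS.isAcyclic.mem_support_of_ne_mem_support_of_adj_of_isPath hp hq ht fun hv => ?_
    classical
    have h1 := SimpleGraph.dist_le (q.takeUntil v hv)
    have h2 := q.length_takeUntil_le_length hv
    omega
  rw [key w hvw h, key u huv.symm hd]

variable (H : HalinGraph)

/-- The step of the walk along the contour of the plane tree. -/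
def HalinGraph.step (d : H.S.Dart) : H.S.Dart := H.rot d.symm

/-- The leaf `l` is the first one that is met on the contour from the dart `d` on. -/
def HalinGraph.IsFirstLeaf (d : H.S.Dart) (l : H.Leaf) : Prop :=
  ∃ m : ℕ, H.step^[m] d = l.1 ∧ ∀ j < m, (H.S.neighborSet (H.step^[j] d).fst).ncard ≠ 1

theorem HalinGraph.IsFirstLeaf.unique {H : HalinGraph} {d : H.S.Dart} {l l' : H.Leaf}
    (h : H.IsFirstLeaf d l) (h' : H.IsFirstLeaf d l') : l = l' := by
  obtain ⟨m, hm, hlt⟩ := h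
  obtain ⟨m', hm', hlt'⟩ := h'
  rcases lt_trichotomy m m' with h | rfl | h
  · exact absurd (by rw [hm]; exact l.2) (hlt' m h)
  · exact Subtype.ext (hm.symm.trans hm')
  · exact absurd (by rw [hm']; exact l'.2) (hlt m' h)

theorem HalinGraph.isFirstLeaf_self (l : H.Leaf) : H.IsFirstLeaf l.1 l :=
  ⟨0, rfl, fun j hj => absurd hj (Nat.not_lt_zero j)⟩

theorem HalinGraph.isFirstLeaf_step (l : H.Leaf) : H.IsFirstLeaf (H.step l.1) (H.next l) := by
  obtain ⟨m, hm, hl, hlt⟩ := H.contour l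
  obtain ⟨m, rfl⟩ := Nat.exists_eq_succ_of_ne_zero hm.ne'
  exact ⟨m, hl, fun j hj => hlt (j + 1) j.succ_pos (Nat.succ_lt_succ hj)⟩

theorem HalinGraph.isFirstLeaf_step_iff {d : H.S.Dart}
    (hd : (H.S.neighborSet d.fst).ncard ≠ 1) (l : H.Leaf) :
    H.IsFirstLeaf (H.step d) l ↔ H.IsFirstLeaf d l := by
  constructor
  · rintro ⟨m, hm, hlt⟩
    refine ⟨m + 1, hm, fun j hj => ?_⟩
    rcases j with _ | j
    · exact hd
    · exact hlt j (Nat.lt_of_succ_lt_succ hj)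
  · rintro ⟨_ | m, hm, hlt⟩
    · exact absurd l.2 (by rw [← hm]; exact hd)
    · exact ⟨m, hm, fun j hj => hlt (j + 1) (Nat.succ_lt_succ hj)⟩

instance : Nonempty H.Leaf :=
  (Nat.card_pos_iff.1 (lt_of_lt_of_le (by norm_num) H.three_le)).1

/-- The first leaf that is met on the contour from the dart `d` on. -/
noncomputable def HalinGraph.firstLeaf (d : H.S.Dart) : H.Leaf :=
  Classical.epsilon (H.IsFirstLeaf d)

theorem HalinGraph.IsFirstLeaf.firstLeaf_eq {H : HalinGraph} {d : H.S.Dart} {l : H.Leaf}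
    (h : H.IsFirstLeaf d l) : H.firstLeaf d = l :=
  (Classical.epsilon_spec ⟨l, h⟩ : H.IsFirstLeaf d (H.firstLeaf d)).unique h

/-- Both sides choose from the same predicate, so it need not be shown that a first leaf exists. -/
theorem HalinGraph.firstLeaf_step {d : H.S.Dart} (hd : (H.S.neighborSet d.fst).ncard ≠ 1) :
    H.firstLeaf (H.step d) = H.firstLeaf d :=
  congrArg Classical.epsilon (funext fun l => propext (H.isFirstLeaf_step_iff hd l))

/-! ### The rotation at leaves and at trivalent vertices -/

theorem HalinGraph.ncard_dart (v : H.V) :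
    {d : H.S.Dart | d.fst = v}.ncard = (H.S.neighborSet v).ncard := by
  refine Set.ncard_congr (fun d _ => d.snd) ?_ ?_ ?_
  · rintro d rfl
    exact d.adj
  · rintro d d' rfl hd' h
    exact SimpleGraph.Dart.ext _ _ (Prod.ext hd'.symm h)
  · intro w hw
    exact ⟨⟨(v, w), hw⟩, rfl, rfl⟩

theorem HalinGraph.fst_rot (d : H.S.Dart) : (H.rot d).fst = d.fst :=
  ((H.rot_cycle _ _).1 (Equiv.Perm.sameCycle_apply_right.2 (Equiv.Perm.SameCycle.refl _ _))).symm

theorem HalinGraph.rot_of_leaf {d : H.S.Dart} (hd : (H.S.neighborSet d.fst).ncard = 1) :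
    H.rot d = d := by
  rw [← H.ncard_dart] at hd
  obtain ⟨a, ha⟩ := Set.ncard_eq_one.1 hd
  have h1 : H.rot d ∈ ({a} : Set _) := ha ▸ H.fst_rot d
  have h2 : d ∈ ({a} : Set _) := ha ▸ rfl
  exact h1.trans h2.symm

/-- The rotation at a trivalent vertex. -/
theorem HalinGraph.rot_of_trivalent (d : H.S.Dart) (hd : (H.S.neighborSet d.fst).ncard ≠ 1) :
    H.rot d ≠ d ∧ H.rot (H.rot d) ≠ d ∧ H.rot (H.rot (H.rot d)) = d ∧
      ∀ d' : H.S.Dart, d'.fst = d.fst → d' = d ∨ d' = H.rot d ∨ d' = H.rot (H.rot d) := by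
  have h3 : {d' : H.S.Dart | d'.fst = d.fst}.ncard = 3 := by
    rw [H.ncard_dart]
    exact (H.cubic _).resolve_left hd
  have hfin : {d' : H.S.Dart | d'.fst = d.fst}.Finite := Set.finite_of_ncard_pos (by omega)
  let s := hfin.toFinset
  have hs : s.card = 3 := by rw [← h3, Set.ncard_eq_toFinset_card _ hfin]
  -- The darts leaving one vertex form a single cycle of `H.rot`, here of length 3, so powers of the
  -- rotation can be compared modulo 3.
  have hcyc : H.rot.IsCycleOn (s : Set H.S.Dart) := by
    constructor
    · refine ⟨fun a ha => ?_, H.rot.injective.injOn, fun a ha => ⟨H.rot.symm a, ?_, by simp⟩⟩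
      · simp only [s, Set.Finite.coe_toFinset, Set.mem_ofPred_eq] at ha ⊢
        rw [H.fst_rot, ha]
      · simp only [s, Set.Finite.coe_toFinset, Set.mem_ofPred_eq] at ha ⊢
        rw [← H.fst_rot, Equiv.apply_symm_apply, ha]
    · intro a ha b hb
      simp only [s, Set.Finite.coe_toFinset, Set.mem_ofPred_eq] at ha hb
      exact (H.rot_cycle a b).2 (ha.trans hb.symm)
  have hds : d ∈ s := by simp [s]
  have h0 := fun n => hcyc.pow_apply_eq hds (n := n)
  rw [hs] at h0
  have h1 : H.rot d ≠ d := fun h => absurd ((h0 1).1 (by simpa using h)) (by decide)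
  refine ⟨h1, fun h => absurd ((h0 2).1 (by simpa [pow_succ] using h)) (by decide), ?_,
    fun d' hd' => ?_⟩
  · have := (h0 3).2 dvd_rfl
    simpa [pow_succ] using this
  · obtain ⟨n, hn, hnd⟩ := hcyc.exists_pow_eq hds (b := d') (by simpa [s] using hd')
    rw [hs] at hn
    interval_cases n
    · exact .inl (by simpa using hnd.symm)
    · exact .inr (.inl (by simpa using hnd.symm))
    · exact .inr (.inr (by simpa [pow_succ] using hnd.symm))

/-! ### Transitions through parts of a Halin graph -/

variable {H}

/-- If the parts of the tree beyond the darts leaving the trivalent head of `d` have admissible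
transitions, then they compose to a transition of the part beyond `d`. -/
theorem HalinGraph.comp_at_trivalent {val : H.S.Dart → Vec} (hsymm : ∀ d, val d.symm = val d)
    (hline : ∀ v, (H.S.neighborSet v).ncard ≠ 1 → IsLine T {y | ∃ d, d.fst = v ∧ y = val d})
    {σ : H.Leaf → Sym2 Vec} {d : H.S.Dart} (hd : (H.S.neighborSet d.snd).ncard ≠ 1)
    (h : ∀ r : H.S.Dart, r.fst = d.snd → r ≠ d.symm →
      Admissible T (σ (H.firstLeaf (H.step r))) (val r) (σ (H.firstLeaf (H.step r.symm)))) :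
    Admissible T (σ (H.firstLeaf (H.step d))) (val d) (σ (H.firstLeaf d.symm)) ∧
      ∃ p t, HasShape T p (σ (H.firstLeaf (H.step d))) ∧ HasShape T t (σ (H.firstLeaf d.symm)) ∧
        (p, weight T (val d), t) ∈ setM' := by
  obtain ⟨h1, h2, h3, hall⟩ := H.rot_of_trivalent d.symm hd
  have f1 : (H.rot d.symm).fst = d.snd := H.fst_rot d.symm
  have f2 : (H.rot (H.rot d.symm)).fst = d.snd := (H.fst_rot _).trans f1
  have hA := h _ f1 h1
  have hB := h _ f2 h2
  -- With `r₁ = H.rot d.symm` and `r₂ = H.rot r₁`, the transition beyond `r₁` ends at `H.firstLeaf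
  -- r₂`, where the one beyond `r₂` starts; the latter ends at `H.firstLeaf d.symm` because the
  -- third rotation returns to `d.symm`.
  rw [H.firstLeaf_step (by rw [f1]; exact hd)] at hA
  rw [H.firstLeaf_step (by rw [f2]; exact hd)] at hB
  simp only [HalinGraph.step, SimpleGraph.Dart.symm_symm, h3] at hA hB ⊢
  refine hA.comp hB ?_
  convert hline d.snd hd using 1
  ext y
  simp only [Set.mem_insert_iff, Set.mem_singleton_iff, Set.mem_ofPred_eq]
  constructor
  · rintro (rfl | rfl | rfl)
    exacts [⟨_, f1, rfl⟩, ⟨_, f2, rfl⟩, ⟨d.symm, rfl, (hsymm d).symm⟩]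
  · rintro ⟨d', hd', rfl⟩
    rcases hall d' hd' with rfl | rfl | rfl
    exacts [.inr (.inr (hsymm d)), .inl rfl, .inr (.inl rfl)]

/-- Let the edges of the inscribed tree carry a flow and let the leaves carry pairs of vectors so that
the transitions at all the leaves other than `x` are admissible. Then the part of the tree beyond
each dart pointing away from `x` has an admissible transition. -/
theorem HalinGraph.admissible_subtree {val : H.S.Dart → Vec} (hsymm : ∀ d, val d.symm = val d)
    (hline : ∀ v, (H.S.neighborSet v).ncard ≠ 1 → IsLine T {y | ∃ d, d.fst = v ∧ y = val d})
    {x : H.Leaf} {σ : H.Leaf → Sym2 Vec}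
    (hleaf : ∀ l, l ≠ x → Admissible T (σ l) (val l.1) (σ (H.next l))) (d : H.S.Dart)
    (hd : H.S.dist x.1.fst d.snd = H.S.dist x.1.fst d.fst + 1) :
    Admissible T (σ (H.firstLeaf (H.step d))) (val d) (σ (H.firstLeaf (H.step d.symm))) := by
  have := H.finite_V
  obtain ⟨N, hN⟩ := (Set.finite_range (H.S.dist x.1.fst)).bddAbove
  have hN : ∀ v, H.S.dist x.1.fst v ≤ N := fun v => hN ⟨v, rfl⟩
  -- Downward induction on the distance from `x`, with `k` bounding how many levels up to the
  -- maximum `N` remain.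
  suffices ∀ k d, H.S.dist x.1.fst d.snd = H.S.dist x.1.fst d.fst + 1 →
      N < H.S.dist x.1.fst d.snd + k →
      Admissible T (σ (H.firstLeaf (H.step d))) (val d) (σ (H.firstLeaf (H.step d.symm))) from
    this (N + 1) d hd (by omega)
  intro k
  induction k with
  | zero => exact fun d _ h => absurd (hN d.snd) (by omega)
  | succ k ih =>
    intro d hd hk
    by_cases hv : (H.S.neighborSet d.snd).ncard = 1
    · let l : H.Leaf := ⟨d.symm, hv⟩
      have hlx : l ≠ x := by
        rintro h
        have : d.snd = x.1.fst := congrArg (fun l : H.Leaf => l.1.fst) h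
        rw [this, SimpleGraph.dist_self] at hd
        omega
      -- At a leaf the contour turns back along the only dart, so the part beyond `d` is the single
      -- fragment at `l`.
      have hs : H.step d = l.1 := H.rot_of_leaf hv
      have hsl : H.firstLeaf (H.step d.symm) = H.next l := (H.isFirstLeaf_step l).firstLeaf_eq
      rw [hs, (H.isFirstLeaf_self l).firstLeaf_eq, hsl, ← hsymm]
      exact hleaf l hlx
    · rw [H.firstLeaf_step (d := d.symm) hv]
      refine (HalinGraph.comp_at_trivalent hsymm hline hv fun r hr hne => ?_).1
      have hdist : H.S.dist x.1.fst r.snd = H.S.dist x.1.fst r.fst + 1 := by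
        rw [hr]
        refine isTree_dist_lt H.isTree d.adj (hr ▸ r.adj) hd fun h => hne ?_
        exact SimpleGraph.Dart.ext _ _ (Prod.ext hr h)
      exact ih r hdist (by rw [hdist, hr]; omega)

/-- Two adjacent leaves would be exchanged by `H.next`, which is impossible in a cycle of length at
least 3. -/
theorem HalinGraph.ncard_neighborSet_snd_ne (x : H.Leaf) :
    (H.S.neighborSet x.1.snd).ncard ≠ 1 := by
  intro hv
  let l : H.Leaf := ⟨x.1.symm, hv⟩
  have h1 : H.next x = l := by
    rw [← (H.isFirstLeaf_step x).firstLeaf_eq, ← (H.isFirstLeaf_self l).firstLeaf_eq]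
    exact congrArg _ (H.rot_of_leaf (d := x.1.symm) hv)
  have h2 : H.next l = x := by
    rw [← (H.isFirstLeaf_step l).firstLeaf_eq, ← (H.isFirstLeaf_self x).firstLeaf_eq]
    exact congrArg _ (H.rot_of_leaf (d := x.1) x.2)
  have h3 : 3 ≤ Nat.card H.Leaf := H.three_le
  have : Finite H.Leaf := Nat.finite_of_card_ne_zero (by omega)
  have := Fintype.ofFinite H.Leaf
  have hcyc : H.next.IsCycleOn (Finset.univ : Finset H.Leaf) := by
    rw [Finset.coe_univ]
    exact H.circuit
  have h := (hcyc.pow_apply_eq (Finset.mem_univ x) (n := 2)).1 (by simp [pow_succ, h1, h2])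
  rw [Finset.card_univ, ← Nat.card_eq_fintype_card] at h
  exact absurd (h3.trans (Nat.le_of_dvd two_pos h)) (by norm_num)

/-- The transition of the whole tree with the leaf `x` removed. -/
theorem HalinGraph.exists_mem_setM' {val : H.S.Dart → Vec} (hsymm : ∀ d, val d.symm = val d)
    (hline : ∀ v, (H.S.neighborSet v).ncard ≠ 1 → IsLine T {y | ∃ d, d.fst = v ∧ y = val d})
    {x : H.Leaf} {σ : H.Leaf → Sym2 Vec}
    (hleaf : ∀ l, l ≠ x → Admissible T (σ l) (val l.1) (σ (H.next l))) :
    ∃ p t, HasShape T p (σ (H.next x)) ∧ HasShape T t (σ x) ∧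
      (p, weight T (val x.1), t) ∈ setM' := by
  have hv := HalinGraph.ncard_neighborSet_snd_ne x
  have hd : H.S.dist x.1.fst x.1.snd = H.S.dist x.1.fst x.1.fst + 1 := by
    rw [SimpleGraph.dist_self, zero_add]
    exact SimpleGraph.dist_eq_one_iff_adj.2 x.1.adj
  have h := (HalinGraph.comp_at_trivalent hsymm hline (σ := σ) hv fun r hr hne =>
    HalinGraph.admissible_subtree hsymm hline hleaf r (by
      rw [hr]
      refine isTree_dist_lt H.isTree x.1.adj (hr ▸ r.adj) hd fun h => hne ?_
      exact SimpleGraph.Dart.ext _ _ (Prod.ext hr h))).2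
  have hx : H.firstLeaf x.1.symm = x := by
    rw [← H.firstLeaf_step (d := x.1.symm) hv]
    have : H.step x.1.symm = x.1 := H.rot_of_leaf x.2
    rw [this, (H.isFirstLeaf_self x).firstLeaf_eq]
  rwa [(H.isFirstLeaf_step x).firstLeaf_eq, hx] at h

/-! ### Halin poles -/

theorem transitions_pole_subset (Γ : HalinSnark T) (x : Γ.H.Leaf) :
    transitions T (Γ.pole x) ⊆ setM' := by
  classical
  rintro ⟨s, i, t⟩ ⟨z, z', hs, ht, φ, hφ, rfl, rfl, rfl⟩
  have hpieces : (Γ.pieces {x}ᶜ).IsFlow T fun e => φ (Quot.mk _ e) := hφ.junction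
  have htree := hpieces.sum_right
  have hfrag := fun l => hpieces.sum_left.sigma l
  have hJ : ∀ {s t}, Γ.Match {x}ᶜ s t →
      φ (Quot.mk _ ((Γ.pieces {x}ᶜ).semi s)) = φ (Quot.mk _ ((Γ.pieces {x}ᶜ).semi t)) :=
    fun h => Multipole.junction_mk_eq φ h
  let val : Γ.H.S.Dart → Vec := fun d => φ (Quot.mk _ (.inr ⟨d.edge, d.edge_mem⟩))
  have hsymm : ∀ d, val d.symm = val d := fun d => by
    simp only [val, SimpleGraph.Dart.edge_symm]
  have hline : ∀ v, (Γ.H.S.neighborSet v).ncard ≠ 1 →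
      IsLine T {y | ∃ d, d.fst = v ∧ y = val d} := by
    intro v hv
    convert htree.2 ⟨v, hv⟩ using 1
    ext y
    constructor
    · rintro ⟨d, rfl, rfl⟩
      exact ⟨⟨d, hv⟩, rfl, rfl⟩
    · rintro ⟨⟨d, hd⟩, h, rfl⟩
      exact ⟨d, congrArg Subtype.val h, rfl⟩
  let semi : (({x}ᶜ : Set Γ.H.Leaf) × Label 1) → Vec := fun s =>
    φ (Quot.mk _ ((Γ.pieces {x}ᶜ).semi (.inl s)))
  -- `σ l` is the pair on the perimeter edges entering position `l`. No fragment is present at `x`,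
  -- so there the pair is read at the output of the preceding fragment.
  let σ : Γ.H.Leaf → Sym2 Vec := fun l =>
    if h : l = x then
      s(semi (⟨Γ.H.next.symm x, Γ.H.prev_ne x⟩, .out 0),
        semi (⟨Γ.H.next.symm x, Γ.H.prev_ne x⟩, .out 1))
    else s(semi (⟨l, h⟩, .inp 0), semi (⟨l, h⟩, .inp 1))
  have hleaf : ∀ l, l ≠ x → Admissible T (σ l) (val l.1) (σ (Γ.H.next l)) := by
    intro l hl
    have hA := (Γ.isFragment l).admissible (hfrag ⟨l, hl⟩)
    have h1 : σ l = s(semi (⟨l, hl⟩, .inp 0), semi (⟨l, hl⟩, .inp 1)) := dif_neg hl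
    have h2 : σ (Γ.H.next l) = s(semi (⟨l, hl⟩, .out 0), semi (⟨l, hl⟩, .out 1)) := by
      by_cases hx : Γ.H.next l = x
      · have : l = Γ.H.next.symm x := by rw [← hx, Equiv.symm_apply_apply]
        subst this
        exact dif_pos hx
      · have hj : ∀ j, semi (⟨l, hl⟩, .out j) = semi (⟨Γ.H.next l, hx⟩, .inp j) :=
          fun j => hJ (.perimeter ⟨l, hl⟩ ⟨Γ.H.next l, hx⟩ rfl j)
        rw [hj, hj]
        exact dif_neg hx
    have h3 : val l.1 = semi (⟨l, hl⟩, .res 0) := (hJ (.tree ⟨l, hl⟩ 0)).symm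
    rw [h1, h2, h3]
    exact hA
  obtain ⟨p, q, hp, hq, hM⟩ := Γ.H.exists_mem_setM' hsymm hline hleaf
  have e1 : σ (Γ.H.next x) = s(semi (⟨Γ.H.next x, Γ.H.next_ne x⟩, .inp 0),
      semi (⟨Γ.H.next x, Γ.H.next_ne x⟩, .inp 1)) := dif_neg (Γ.H.next_ne x)
  have e2 : σ x = s(semi (⟨Γ.H.next.symm x, Γ.H.prev_ne x⟩, .out 0),
      semi (⟨Γ.H.next.symm x, Γ.H.prev_ne x⟩, .out 1)) := dif_pos rfl
  rw [e1] at hp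
  rw [e2] at hq
  obtain rfl := hs.unique hp
  obtain rfl := ht.unique hq
  exact hM

end HalinPole

theorem theorem8p3 (T : HalinPole.Tetrahedron) (X : HalinPole.Dipole 1)
    (hX : HalinPole.IsHalinPole T X) :
    HalinPole.transitions T X ⊆ HalinPole.setM' := by
  obtain ⟨Γ, x, rfl⟩ := hX
  exact HalinPole.transitions_pole_subset Γ x
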